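/- Let $\mathcal C$ be a triangulated category. A \emph{weight structure} $w$ on $\mathcal C$ is given by a pair of classes of objects $(\mathrm{LO},\mathrm{RO})$ such that $\mathrm{RO}=\{Y:\mathcal C(X,Y)=0\ \forall X\in \mathrm{LO}\}$, $\mathrm{LO}=\{X:\mathcal C(X,Y)=0\ \forall Y\in \mathrm{RO}\}$, every object $M$ fits into a distinguished triangle $L\to M\to R\to L[1]$ with $L\in\mathrm{LO}$, $R\in\mathrm{RO}$, and $\mathrm{LO}\subset\mathrm{LO}[1]$. Put $\mathcal C_{w\le k}=\mathrm{LO}[k]$ and $\mathcal C_{w\ge k}=\mathrm{RO}[k-1]$ for $k\in\mathbb Z$. A \emph{$k$-weight decomposition} of $X$ is a distinguished triangle $w_{\le k}X\to X\to w_{\ge k+1}X\to (w_{\le k}X)[1]$ with $w_{\le k}X\in\mathcal C_{w\le k}$ and $w_{\ge k+1}X\in\mathcal C_{w\ge k+1}$ (it exists but is not canonical; $w_{\le k}X$ and $w_{\ge k+1}X$ always denote choices coming from such a triangle, together with the corresponding morphisms). For $k<l$ and any choices of $w_{\le k}X$, $w_{\le l}X$ there is a unique \emph{connecting morphism} $w_{\le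 k}X\to w_{\le l}X$ compatible with the morphisms to $X$. Let $m\le n$ be integers. An object $M$ of $\mathcal C$ is \emph{without weights $m,\dots,n$} if there are choices of $w_{\le n}M$ and $w_{\le m-1}M$ such that $w_{\le n}M\to M$ factors through $w_{\le m-1}M\to M$. A cohomological functor $H$ from $\mathcal C$ to an abelian category (that is, a contravariant functor converting distinguished triangles into long exact sequences) is \emph{of weight range $[m,n]$} if it annihilates $\mathcal C_{w\le m-1}$ and $\mathcal C_{w\ge n+1}$. For a contravariant functor $H$ from $\mathcal C$ to an abelian category, the \emph{virtual $t$-truncation} $\tau_{\le n}(H)$ is given by $\tau_{\le n}(H)(M)=\operatorname{Im}(H(w_{\le n+1}M)\to H(w_{\le n}M))$, the image of $H$ of the connecting morphism, for an arbitrary choice of $w_{\le n}M$, $w_{\le n+1}M$. Write $H_I=\mathcal C(-,I)$. An object $X$ is an \emph{extension of $B$ by $A$} if there is a distinguished triangle $A\to X\to B\to A[1]$. \textbf{I.} For every object $M$ of $\mathcal C$ the following conditions are equivalent. \begin{enumerate} \item $M$ is without weights $m,\dots,n$. \item $M$ is a retract of some object $\widetilde M$ that is an extension of an element of $\mathcal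 C_{w\ge n+1}$ by an element of $\mathcal C_{w\le m-1}$. \item $H(M)=0$ for every cohomological functor $H$ of weight range $[m,n]$ with values in any abelian category. \item $\tau_{\le n}(H_I)(M)=0$ for all $I\in\mathcal C_{w\ge m}$ (equivalently for all, or for some, choices of the truncations of $M$ used to compute it). \item $\tau_{\le n}(H_{I_0})(M)=0$, where $I_0$ is a choice of $w_{\ge m}M$ (equivalently for all, or for some, choices of $I_0$ and of the truncations of $M$). \end{enumerate} \textbf{II.} If moreover $\mathcal C$ is idempotent complete (all idempotent endomorphisms split), then these conditions are also equivalent to each of the following. \begin{enumerate} \item $M$ itself is an extension of an element of $\mathcal C_{w\ge n+1}$ by an element of $\mathcal C_{w\le m-1}$. \item There exist choices of $w_{\le m-1}M$ and $w_{\le n}M$ that are isomorphic objects. \item There exist choices of $w_{\le m-1}M$ and $w_{\le n}M$ such that the connecting morphism $w_{\le m-1}M\to w_{\le n}M$ is an isomorphism. \end{enumerate} -/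

import Mathlib

open CategoryTheory CategoryTheory.Limits CategoryTheory.Pretriangulated Opposite
open scoped CategoryTheory.Pretriangulated.Opposite

universe u v uA vA

section

variable (C : Type u) [Category.{v} C] [Preadditive C] [HasZeroObject C] [HasShift C ℤ]
  [∀ k : ℤ, (shiftFunctor C k).Additive] [Pretriangulated C]

/-- A torsion theory `(LO, RO)`: `LO^⊥ = RO`, `LO = ^⊥RO`, and every object `M` has a
decomposition triangle `L ⟶ M ⟶ R ⟶ L⟦1⟧` with `L ∈ LO` and `R ∈ RO`. -/
structure TorsionTheory where
  lo : ObjectProperty C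
  ro : ObjectProperty C
  rightOrthogonal_lo : lo.rightOrthogonal = ro
  leftOrthogonal_ro : ro.leftOrthogonal = lo
  exists_triangle (M : C) : ∃ (L R : C) (_ : lo L) (_ : ro R) (a : L ⟶ M) (b : M ⟶ R)
    (d : R ⟶ L⟦(1 : ℤ)⟧), Triangle.mk a b d ∈ distTriang C

/-- A weight structure: a torsion theory with `LO ⊆ LO[1]`.
For a class `P` of objects closed under isomorphisms, `P[k]` is `P.shift (-k)`, that is,
`X ∈ P[k]` if and only if `X⟦-k⟧ ∈ P`. -/
structure WeightStructure extends TorsionTheory C where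
  weighted : lo ≤ lo.shift (-1 : ℤ)

end

section

variable {C : Type u} [Category.{v} C] [Preadditive C] [HasZeroObject C] [HasShift C ℤ]
  [∀ k : ℤ, (shiftFunctor C k).Additive] [Pretriangulated C]

/-- `X` is an extension of `B` by `A`: there is a distinguished triangle
`A ⟶ X ⟶ B ⟶ A⟦1⟧`. -/
def IsExtensionOf (X B A : C) : Prop :=
  ∃ (f : A ⟶ X) (g : X ⟶ B) (h : B ⟶ A⟦(1 : ℤ)⟧), Triangle.mk f g h ∈ distTriang C

namespace WeightStructure

/-- `C_{w ≤ k} = LO[k]`. -/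
def le (w : WeightStructure C) (k : ℤ) : ObjectProperty C := w.lo.shift (-k)

/-- `C_{w ≥ k} = (RO[-1])[k]`. -/
def ge (w : WeightStructure C) (k : ℤ) : ObjectProperty C :=
  (w.ro.shift (1 : ℤ)).shift (-k)

/-- A `k`-weight decomposition of `X`: a distinguished triangle
`w_{≤k} X ⟶ X ⟶ w_{≥k+1} X ⟶ (w_{≤k} X)⟦1⟧`, that is, a choice of `w_{≤k} X` and
`w_{≥k+1} X` together with the morphisms relating them to `X`. -/
structure Decomposition (w : WeightStructure C) (k : ℤ) (X : C) where
  left : C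
  right : C
  ι : left ⟶ X
  π : X ⟶ right
  δ : right ⟶ left⟦(1 : ℤ)⟧
  distinguished : Triangle.mk ι π δ ∈ distTriang C
  left_le : w.le k left
  right_ge : w.ge (k + 1) right

/-- Choices of `w_{≤k} X` and `w_{≤l} X` (for `k < l`), together with the connecting morphism
`w_{≤k} X ⟶ w_{≤l} X` over `X`. -/
structure TruncationPair (w : WeightStructure C) (k l : ℤ) (X : C) where
  lower : w.Decomposition k X
  upper : w.Decomposition l X
  conn : lower.left ⟶ upper.left
  conn_ι : conn ≫ upper.ι = lower.ι

/-- `g` kills weights `m, …, n`: for some choice of `w_{≤n} M` and `w_{≤m-1} N`, the composition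
`w_{≤n} M ⟶ M ⟶ N` factors through `w_{≤m-1} N ⟶ N`. -/
def KillsWeights (w : WeightStructure C) (m n : ℤ) {M N : C} (g : M ⟶ N) : Prop :=
  ∃ (D : w.Decomposition n M) (E : w.Decomposition (m - 1) N) (h : D.left ⟶ E.left),
    h ≫ E.ι = D.ι ≫ g

/-- `M` is without weights `m, …, n`. -/
def IsWithoutWeights (w : WeightStructure C) (m n : ℤ) (M : C) : Prop :=
  w.KillsWeights m n (𝟙 M)

/-- The contravariant functor `H` is cohomological and of weight range `[m, n]`: it annihilates
`C_{w ≤ m-1}` and `C_{w ≥ n+1}`. -/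
structure IsOfWeightRange (w : WeightStructure C) (m n : ℤ) {A : Type uA} [Category.{vA} A]
    [Abelian A] (H : Cᵒᵖ ⥤ A) : Prop where
  cohomological : H.IsHomological
  isZero_of_le (X : C) (hX : w.le (m - 1) X) : IsZero (H.obj (op X))
  isZero_of_ge (X : C) (hX : w.ge (n + 1) X) : IsZero (H.obj (op X))

/-- The value at `X` of the virtual `t`-truncation `τ_{≤k}(H)`, namely
`Im (H(w_{≤k+1} X) ⟶ H(w_{≤k} X))`, computed by means of given choices of `w_{≤k} X` and
`w_{≤k+1} X`. -/
noncomputable def virtualTruncation {w : WeightStructure C} {k : ℤ} {X : C} {A : Type uA}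
    [Category.{vA} A] [Abelian A] (H : Cᵒᵖ ⥤ A) (T : w.TruncationPair k (k + 1) X) : A :=
  image (H.map T.conn.op)

end WeightStructure

end

/-! A morphism `h : w_{≤n} M ⟶ w_{≤m-1} M` over `M` does all the work. Pushing the triangle of
`w_{≤n} M` out along `h` gives an extension having `M` as a retract (`exists_retract`), and a
functor of weight range `[m, n]` kills such extensions. The existence of `h` amounts to the
vanishing of `w_{≤n} M ⟶ M ⟶ w_{≥m} M`, which is an element of `τ_{≤n}(H_I)(M)` for `I = w_{≥m} M`.
So this one test functor suffices, once `τ_{≤n}(H_I)` is known to be cohomological of weight range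
`[m, n]` (`exists_truncMap_comp_eq`, `truncYoneda_isOfWeightRange`).

When idempotents split, `h` and the connecting morphism `c` satisfy `c ≫ h ≫ c = c`, and the image
of `c ≫ h` is a common choice of `w_{≤m-1} M` and `w_{≤n} M` (`exists_isExtensionOf`). -/

section

variable {C : Type u} [Category.{v} C] [Preadditive C] [HasZeroObject C] [HasShift C ℤ]
  [∀ k : ℤ, (shiftFunctor C k).Additive] [Pretriangulated C]

/-- The middle object of a distinguished triangle may be replaced by an isomorphic one. -/
lemma distinguished_of_iso₂ {A X Y B : C} {f : A ⟶ X} {g : X ⟶ B} {h : B ⟶ A⟦(1 : ℤ)⟧}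
    (hT : Triangle.mk f g h ∈ distTriang C) (e : X ≅ Y) :
    Triangle.mk (f ≫ e.hom) (e.inv ≫ g) h ∈ distTriang C :=
  isomorphic_distinguished _ hT _
    (Triangle.isoMk _ _ (Iso.refl A) e.symm (Iso.refl B)
      (show (f ≫ e.hom) ≫ e.inv = 𝟙 A ≫ f by simp)
      (show (e.inv ≫ g) ≫ 𝟙 B = e.inv ≫ g by simp)
      (show h ≫ (𝟙 A)⟦(1 : ℤ)⟧' = 𝟙 B ≫ h by simp))

lemma exists_comp_eq_of_comp_shift_map_eq_zero {A X B Y : C} {f : A ⟶ X} {g : X ⟶ B}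
    {h : B ⟶ A⟦(1 : ℤ)⟧} (hT : Triangle.mk f g h ∈ distTriang C) (a : Y ⟶ A⟦(1 : ℤ)⟧)
    (ha : a ≫ f⟦(1 : ℤ)⟧' = 0) : ∃ b : Y ⟶ B, b ≫ h = a := by
  obtain ⟨b, hb⟩ := Triangle.coyoneda_exact₁ _ hT a ha
  exact ⟨b, hb.symm⟩

/-! ### Weight classes, orthogonality and weight decompositions -/

namespace WeightStructure

variable (w : WeightStructure C)

instance : w.lo.IsClosedUnderIsomorphisms := by
  rw [← w.leftOrthogonal_ro]; infer_instance

instance : w.ro.IsClosedUnderIsomorphisms := by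
  rw [← w.rightOrthogonal_lo]; infer_instance

instance (k : ℤ) : (w.le k).IsClosedUnderIsomorphisms := by
  unfold le; infer_instance

variable {w}

lemma le_iff_lo_shift {k : ℤ} {X : C} : w.le k X ↔ w.lo (X⟦-k⟧) := Iff.rfl

/-- The two shifts in `ge` combine, so that `(w.le k, w.ge (k + 1))` is the pair `(LO, RO)` shifted
by `k`. -/
lemma ge_succ_iff_ro_shift {k : ℤ} {X : C} : w.ge (k + 1) X ↔ w.ro (X⟦-k⟧) := by
  unfold ge
  rw [w.ro.shift_shift (-(k + 1)) 1 (-k) (by lia)]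
  rfl

lemma le_shift_of_lo {k : ℤ} {X : C} (hX : w.lo X) : w.le k (X⟦k⟧) :=
  w.lo.prop_of_iso ((shiftFunctorCompIsoId C k (-k) (by simp)).symm.app X) hX

lemma ge_succ_shift_of_ro {k : ℤ} {X : C} (hX : w.ro X) : w.ge (k + 1) (X⟦k⟧) :=
  ge_succ_iff_ro_shift.2
    (w.ro.prop_of_iso ((shiftFunctorCompIsoId C k (-k) (by simp)).symm.app X) hX)

lemma zero_of_lo_of_ro {X Y : C} (hX : w.lo X) (hY : w.ro Y) (f : X ⟶ Y) : f = 0 := by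
  rw [← w.rightOrthogonal_lo] at hY
  exact hY f hX

lemma zero_of_le_of_ge_succ {k : ℤ} {X Y : C} (hX : w.le k X) (hY : w.ge (k + 1) Y)
    (f : X ⟶ Y) : f = 0 :=
  (shiftFunctor C (-k)).map_injective (by
    rw [Functor.map_zero]
    exact zero_of_lo_of_ro hX (ge_succ_iff_ro_shift.1 hY) _)

lemma le_of_forall_zero {k : ℤ} {X : C}
    (h : ∀ ⦃Y : C⦄, w.ge (k + 1) Y → ∀ f : X ⟶ Y, f = 0) : w.le k X := by
  rw [le_iff_lo_shift, ← w.leftOrthogonal_ro]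
  intro Y f hY
  apply (shiftFunctor C k).map_injective
  rw [Functor.map_zero, ← cancel_epi ((shiftFunctorCompIsoId C (-k) k (by simp)).inv.app X),
    comp_zero]
  exact h (ge_succ_shift_of_ro hY) _

lemma ge_succ_of_forall_zero {k : ℤ} {Y : C}
    (h : ∀ ⦃X : C⦄, w.le k X → ∀ f : X ⟶ Y, f = 0) : w.ge (k + 1) Y := by
  rw [ge_succ_iff_ro_shift, ← w.rightOrthogonal_lo]
  intro X f hX
  apply (shiftFunctor C k).map_injective
  rw [Functor.map_zero, ← cancel_mono ((shiftFunctorCompIsoId C (-k) k (by simp)).hom.app Y),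
    zero_comp]
  exact h (le_shift_of_lo hX) _

lemma le_mono {k l : ℤ} (hkl : k ≤ l) : w.le k ≤ w.le l := by
  induction l, hkl using Int.leInduction with
  | base => exact le_rfl
  | succ l _ ih =>
    intro X hX
    have h : (w.lo.shift (-1 : ℤ)).shift (-l) X := w.weighted _ (ih X hX)
    rwa [w.lo.shift_shift (-l) (-1) (-(l + 1)) (by lia)] at h

lemma le_shift_add {k : ℤ} {X : C} (hX : w.le k X) (j : ℤ) : w.le (k + j) (X⟦j⟧) :=
  w.lo.prop_of_iso ((shiftFunctorAdd' C j (-(k + j)) (-k) (by lia)).app X) hX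

lemma zero_of_le_of_ge {k l : ℤ} (hkl : k < l) {X Y : C} (hX : w.le k X) (hY : w.ge l Y)
    (f : X ⟶ Y) : f = 0 := by
  obtain ⟨l, rfl⟩ : ∃ j, l = j + 1 := ⟨l - 1, by simp⟩
  exact zero_of_le_of_ge_succ (le_mono (by lia) _ hX) hY f

lemma ge_anti {k l : ℤ} (hkl : k ≤ l) : w.ge l ≤ w.ge k := by
  intro Y hY
  obtain ⟨k, rfl⟩ : ∃ j, k = j + 1 := ⟨k - 1, by simp⟩
  exact ge_succ_of_forall_zero fun X hX f ↦ zero_of_le_of_ge (by lia) hX hY f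

lemma le_of_retract {k : ℤ} {X Y : C} (r : Retract X Y) (hY : w.le k Y) : w.le k X :=
  le_of_forall_zero fun Z hZ f ↦ by
    rw [← Category.id_comp f, ← r.retract, Category.assoc,
      zero_of_le_of_ge_succ hY hZ (r.r ≫ f), comp_zero]

lemma le_of_distinguished {k : ℤ} (T : Triangle C) (hT : T ∈ distTriang C)
    (h₁ : w.le k T.obj₁) (h₃ : w.le k T.obj₃) : w.le k T.obj₂ :=
  le_of_forall_zero fun Y hY f ↦ by
    obtain ⟨g, rfl⟩ := T.yoneda_exact₂ hT f (zero_of_le_of_ge_succ h₁ hY _)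
    rw [zero_of_le_of_ge_succ h₃ hY g, comp_zero]

variable (w) in
lemma exists_decomposition (k : ℤ) (X : C) : Nonempty (w.Decomposition k X) := by
  obtain ⟨L, R, hL, hR, a, b, d, hT⟩ := w.exists_triangle (X⟦-k⟧)
  exact ⟨{
    left := L⟦k⟧
    right := R⟦k⟧
    ι := _
    π := _
    δ := _
    distinguished := distinguished_of_iso₂ (Triangle.shift_distinguished _ hT k)
      ((shiftFunctorCompIsoId C (-k) k (by simp)).app X)
    left_le := le_shift_of_lo hL
    right_ge := ge_succ_shift_of_ro hR }⟩

namespace Decomposition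

variable {k l : ℤ} {X : C}

/-- A morphism annihilated by `D.π` factors through `D.ι`. -/
lemma exists_lift (D : w.Decomposition k X) {L : C} (f : L ⟶ X) (hf : f ≫ D.π = 0) :
    ∃ g : L ⟶ D.left, g ≫ D.ι = f := by
  obtain ⟨g, hg⟩ := Triangle.coyoneda_exact₂ _ D.distinguished f hf
  exact ⟨g, hg.symm⟩

lemma exists_lift_of_le (D : w.Decomposition k X) {L : C} (hL : w.le l L) (hlk : l ≤ k)
    (f : L ⟶ X) : ∃ g : L ⟶ D.left, g ≫ D.ι = f :=
  D.exists_lift f (zero_of_le_of_ge (by lia) hL D.right_ge _)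

/-- Morphisms from an object of smaller weight to `w_{≤k} X` are determined by their
composition with `w_{≤k} X ⟶ X`. -/
lemma eq_zero_of_comp_ι (D : w.Decomposition k X) {L : C} (hL : w.le l L) (hlk : l < k)
    (f : L ⟶ D.left) (hf : f ≫ D.ι = 0) : f = 0 := by
  apply (shiftFunctor C (1 : ℤ)).map_injective
  rw [Functor.map_zero]
  -- `f⟦1⟧` comes from a morphism `L⟦1⟧ ⟶ w_{≥k+1} X`, which vanishes because `l + 1 ≤ k`; this is
  -- where `l < k` must be strict.
  obtain ⟨g, hg⟩ := exists_comp_eq_of_comp_shift_map_eq_zero D.distinguished (f⟦(1 : ℤ)⟧')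
    (by rw [← Functor.map_comp, hf, Functor.map_zero])
  rw [← hg, zero_of_le_of_ge (by lia) (le_shift_add hL 1) D.right_ge g, zero_comp]

lemma eq_of_comp_ι (D : w.Decomposition k X) {L : C} (hL : w.le l L) (hlk : l < k)
    {f g : L ⟶ D.left} (hfg : f ≫ D.ι = g ≫ D.ι) : f = g :=
  sub_eq_zero.1 (D.eq_zero_of_comp_ι hL hlk _ (by rw [Preadditive.sub_comp, hfg, sub_self]))

end Decomposition

variable (w) in
lemma exists_truncationPair {k l : ℤ} (hkl : k ≤ l) (X : C) :
    Nonempty (w.TruncationPair k l X) := by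
  obtain ⟨D⟩ := w.exists_decomposition k X
  obtain ⟨E⟩ := w.exists_decomposition l X
  obtain ⟨c, hc⟩ := E.exists_lift_of_le D.left_le hkl D.ι
  exact ⟨⟨D, E, c, hc⟩⟩

end WeightStructure

end

/-! ### The virtual truncation of a representable functor -/

section

variable {C : Type u} [Category.{v} C] [Preadditive C] [HasZeroObject C] [HasShift C ℤ]
  [∀ k : ℤ, (shiftFunctor C k).Additive] [Pretriangulated C]

namespace WeightStructure

variable {w : WeightStructure C} {n : ℤ} {X Y Z I : C}

/-- The morphisms `w_{≤n} X ⟶ I` that are compatible with the restriction of `X` to objects of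
weight `≤ n`. These correspond to the natural transformations from `C(-, X)` to `C(-, I)` on
`C_{w ≤ n}`. -/
def Decomposition.compatibleHom (D : w.Decomposition n X) (I : C) : AddSubgroup (D.left ⟶ I) where
  carrier := {f | ∀ ⦃L : C⦄, w.le n L → ∀ g : L ⟶ D.left, g ≫ D.ι = 0 → g ≫ f = 0}
  add_mem' hf hf' L hL g hg := by
    rw [Preadditive.comp_add, hf hL g hg, hf' hL g hg, add_zero]
  zero_mem' := by simp
  neg_mem' hf L hL g hg := by rw [Preadditive.comp_neg, hf hL g hg, neg_zero]

lemma Decomposition.comp_eq_comp_of_mem (D : w.Decomposition n X) {f : D.left ⟶ I}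
    (hf : f ∈ D.compatibleHom I) {L : C} (hL : w.le n L) {g g' : L ⟶ D.left}
    (h : g ≫ D.ι = g' ≫ D.ι) : g ≫ f = g' ≫ f := by
  rw [← sub_eq_zero, ← Preadditive.sub_comp]
  exact hf hL _ (by rw [Preadditive.sub_comp, h, sub_self])

lemma Decomposition.comp_mem_compatibleHom (D : w.Decomposition n X) (E : w.Decomposition n Y)
    {φ : X ⟶ Y} {ψ : D.left ⟶ E.left} (h : ψ ≫ E.ι = D.ι ≫ φ) {f : E.left ⟶ I}
    (hf : f ∈ E.compatibleHom I) : ψ ≫ f ∈ D.compatibleHom I := fun L hL g hg ↦ by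
  rw [← Category.assoc]
  exact hf hL _ (by rw [Category.assoc, h, ← Category.assoc, hg, zero_comp])

variable (w) in
/-- A chosen weight decomposition. -/
noncomputable def decomposition (n : ℤ) (X : C) : w.Decomposition n X :=
  (w.exists_decomposition n X).some

variable (w n) in
/-- A chosen extension of a morphism to the chosen weight decompositions. -/
noncomputable def truncMap (φ : X ⟶ Y) : (w.decomposition n X).left ⟶ (w.decomposition n Y).left :=
  ((w.decomposition n Y).exists_lift_of_le (w.decomposition n X).left_le le_rfl
    ((w.decomposition n X).ι ≫ φ)).choose

lemma truncMap_ι (φ : X ⟶ Y) :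
    w.truncMap n φ ≫ (w.decomposition n Y).ι = (w.decomposition n X).ι ≫ φ :=
  ((w.decomposition n Y).exists_lift_of_le (w.decomposition n X).left_le le_rfl
    ((w.decomposition n X).ι ≫ φ)).choose_spec

lemma truncMap_comp_eq {φ : X ⟶ Y} {ψ : (w.decomposition n X).left ⟶ (w.decomposition n Y).left}
    (h : ψ ≫ (w.decomposition n Y).ι = (w.decomposition n X).ι ≫ φ)
    {f : (w.decomposition n Y).left ⟶ I} (hf : f ∈ (w.decomposition n Y).compatibleHom I) :
    w.truncMap n φ ≫ f = ψ ≫ f :=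
  (w.decomposition n Y).comp_eq_comp_of_mem hf (w.decomposition n X).left_le
    ((truncMap_ι φ).trans h.symm)

variable (w n I) in
/-- The virtual `t`-truncation `τ_{≤n}` of the functor represented by `I`. -/
noncomputable def truncYoneda : Cᵒᵖ ⥤ AddCommGrpCat.{v} where
  obj X := AddCommGrpCat.of ((w.decomposition n X.unop).compatibleHom I)
  map φ := AddCommGrpCat.ofHom
    { toFun f := ⟨w.truncMap n φ.unop ≫ f.1,
        Decomposition.comp_mem_compatibleHom _ _ (truncMap_ι φ.unop) f.2⟩
      map_zero' := Subtype.ext comp_zero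
      map_add' _ _ := Subtype.ext (Preadditive.comp_add _ _ _ _ _ _) }
  map_id X := by
    ext f
    exact (truncMap_comp_eq (ψ := 𝟙 _) (by simp) f.2).trans (Category.id_comp _)
  map_comp φ ψ := by
    ext f
    exact (truncMap_comp_eq (ψ := w.truncMap n ψ.unop ≫ w.truncMap n φ.unop)
      (by rw [Category.assoc, truncMap_ι, ← Category.assoc, truncMap_ι, unop_comp,
        Category.assoc]) f.2).trans (Category.assoc _ _ _)

/-- The half-exactness of the virtual `t`-truncation. -/
lemma exists_truncMap_comp_eq (T : Triangle C) (hT : T ∈ distTriang C)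
    {f : (w.decomposition n T.obj₂).left ⟶ I}
    (hf : f ∈ (w.decomposition n T.obj₂).compatibleHom I) (hf₁ : w.truncMap n T.mor₁ ≫ f = 0) :
    ∃ f' ∈ (w.decomposition n T.obj₃).compatibleHom I, w.truncMap n T.mor₂ ≫ f' = f := by
  let D := w.decomposition n T.obj₂
  let E := w.decomposition n T.obj₃
  let W := w.decomposition (n + 1) T.obj₃
  obtain ⟨c, hc⟩ := W.exists_lift_of_le E.left_le (by lia) E.ι
  have hfv (L : C) (hL : w.le n L) (g : L ⟶ D.left) (hg : (g ≫ D.ι) ≫ T.mor₂ = 0) :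
      g ≫ f = 0 := by
    -- The morphism to `T.obj₂` comes from `T.obj₁`, hence from its truncation, on which `f`
    -- vanishes by `hf₁`.
    obtain ⟨k, hk⟩ := T.coyoneda_exact₂ hT _ hg
    obtain ⟨k', rfl⟩ := (w.decomposition n T.obj₁).exists_lift_of_le hL le_rfl k
    rw [D.comp_eq_comp_of_mem hf hL (g' := k' ≫ w.truncMap n T.mor₁)
      (by rw [hk, Category.assoc, Category.assoc, truncMap_ι]), Category.assoc, hf₁, comp_zero]
  -- The fibre `Q` is an extension of `D.left` by `W.left⟦-1⟧`, both of weight `≤ n`, so `hfv`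
  -- applies to it and `f` extends to `W.left`. Using `W` at level `n + 1` rather than `E` makes `c
  -- ≫ f'` compatible.
  obtain ⟨Q, q, r, hQ⟩ := distinguished_cocone_triangle₁ (w.truncMap n T.mor₂ ≫ c)
  have hQn : w.le n Q := by
    refine le_of_distinguished _ (inv_rot_of_distTriang _ hQ) ?_ D.left_le
    simpa using le_shift_add W.left_le (-1)
  have hq : q ≫ w.truncMap n T.mor₂ ≫ c = 0 := comp_distTriang_mor_zero₁₂ _ hQ
  obtain ⟨f', hf'⟩ : ∃ f' : W.left ⟶ I, f = (w.truncMap n T.mor₂ ≫ c) ≫ f' :=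
    Triangle.yoneda_exact₂ _ hQ f (hfv Q hQn q (by
      rw [Category.assoc, ← truncMap_ι, ← hc]
      simpa using hq =≫ W.ι))
  refine ⟨c ≫ f', fun L hL g hg ↦ ?_, by rw [hf', Category.assoc]⟩
  rw [← Category.assoc, W.eq_zero_of_comp_ι hL (by lia) (g ≫ c) (by rw [Category.assoc, hc, hg]),
    zero_comp]

instance : (w.truncYoneda n I).PreservesZeroMorphisms where
  map_zero X Y := by
    ext f
    refine Subtype.ext ?_
    exact (truncMap_comp_eq (ψ := 0) (by simp) f.2).trans zero_comp

instance : (w.truncYoneda n I).IsHomological where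
  exact T hT := by
    rw [ShortComplex.ab_exact_iff]
    intro (f : (w.decomposition n T.obj₂.unop).compatibleHom I) hf
    obtain ⟨f', hf', h⟩ := exists_truncMap_comp_eq _ (unop_distinguished T hT) f.2
      (congr_arg Subtype.val hf)
    exact ⟨⟨f', hf'⟩, Subtype.ext h⟩

lemma isZero_truncYoneda_iff :
    IsZero ((w.truncYoneda n I).obj (op X)) ↔
      ∀ f ∈ (w.decomposition n X).compatibleHom I, f = 0 := by
  rw [AddCommGrpCat.isZero_iff_subsingleton]
  constructor
  · intro h f hf
    exact congr_arg Subtype.val (h.elim (⟨f, hf⟩ : (w.decomposition n X).compatibleHom I) 0)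
  · intro h
    exact ⟨fun f g ↦ Subtype.ext ((h _ f.2).trans (h _ g.2).symm)⟩

lemma truncYoneda_isOfWeightRange {m : ℤ} (hmn : m ≤ n + 1) (hI : w.ge m I) :
    w.IsOfWeightRange m n (w.truncYoneda n I) where
  cohomological := inferInstance
  isZero_of_le X hX := by
    rw [isZero_truncYoneda_iff]
    intro f hf
    let D := w.decomposition n X
    -- As `D.ι` has a section `s`, compatibility forces `f = D.ι ≫ s ≫ f`, and `s ≫ f : X ⟶ I`
    -- vanishes by weights.
    obtain ⟨s, hs⟩ := D.exists_lift_of_le hX (by lia) (𝟙 X)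
    rw [← Category.id_comp f, D.comp_eq_comp_of_mem hf D.left_le (g' := D.ι ≫ s) (by
      rw [Category.assoc, hs, Category.comp_id]; exact Category.id_comp _),
      Category.assoc, zero_of_le_of_ge (by lia) hX hI (s ≫ f), comp_zero]
  isZero_of_ge X hX := by
    rw [isZero_truncYoneda_iff]
    intro f hf
    let D := w.decomposition n X
    rw [← Category.id_comp f]
    exact hf D.left_le (𝟙 _) (zero_of_le_of_ge_succ D.left_le hX _)

end WeightStructure

end

/-! ### Transport of test functors to larger universes -/

/-- Every abelian category is equivalent to an abelian category in larger universes. -/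
lemma exists_abelian_equivalence_ulift (A : Type u) [Category.{v} A] [Abelian A] :
    ∃ (B : Type (max u uA)) (_ : Category.{max v vA} B) (_ : Abelian B), Nonempty (A ≌ B) := by
  let : Category.{v} (ULift.{uA} A) := uliftCategory A
  let e : A ≌ ULiftHom.{vA} (ULift.{uA} A) := ULift.equivalence.trans ULiftHom.equiv
  let := Preadditive.ofFullyFaithful e.fullyFaithfulInverse
  have : HasFiniteProducts (ULiftHom.{vA} (ULift.{uA} A)) :=
    ⟨fun _ ↦ Adjunction.hasLimitsOfShape_of_equivalence e.inverse⟩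
  exact ⟨ULiftHom.{vA} (ULift.{uA} A), inferInstance, abelianOfEquivalence e.inverse, ⟨e⟩⟩

section

variable {C : Type u} [Category.{v} C] [Preadditive C] [HasZeroObject C] [HasShift C ℤ]
  [∀ k : ℤ, (shiftFunctor C k).Additive] [Pretriangulated C]

lemma CategoryTheory.Functor.IsHomological.comp_equivalence {A B : Type*} [Category* A]
    [Category* B] [Abelian A] [Abelian B] {H : C ⥤ A} (hH : H.IsHomological) (e : A ≌ B) :
    (H ⋙ e.functor).IsHomological where
  map_zero X Y := by
    rw [Functor.comp_map, H.map_zero]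
    exact e.functor.map_zero _ _
  exact T hT := (hH.exact T hT).map e.functor

namespace WeightStructure

lemma IsOfWeightRange.comp_equivalence {w : WeightStructure C} {m n : ℤ} {A B : Type*}
    [Category* A] [Category* B] [Abelian A] [Abelian B] {H : Cᵒᵖ ⥤ A}
    (hH : w.IsOfWeightRange m n H) (e : A ≌ B) : w.IsOfWeightRange m n (H ⋙ e.functor) where
  cohomological := hH.cohomological.comp_equivalence e
  isZero_of_le X hX := e.functor.map_isZero (hH.isZero_of_le X hX)
  isZero_of_ge X hX := e.functor.map_isZero (hH.isZero_of_ge X hX)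

end WeightStructure

end

/-! ### The equivalent conditions -/

section

variable {C : Type u} [Category.{v} C] [Preadditive C] [HasZeroObject C] [HasShift C ℤ]
  [∀ k : ℤ, (shiftFunctor C k).Additive] [Pretriangulated C]

namespace WeightStructure

variable {w : WeightStructure C} {m n : ℤ} {M : C}

lemma Decomposition.right_ge_pred (D : w.Decomposition (m - 1) M) : w.ge m D.right := by
  simpa using D.right_ge

lemma IsWithoutWeights.of_comp_π_eq_zero (D : w.Decomposition n M)
    (E : w.Decomposition (m - 1) M) (h : D.ι ≫ E.π = 0) : w.IsWithoutWeights m n M := by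
  obtain ⟨g, hg⟩ := E.exists_lift D.ι h
  exact ⟨D, E, g, by rw [hg, Category.comp_id]⟩

lemma isZero_virtualTruncation_iff {k : ℤ} {X I : C} (T : w.TruncationPair k (k + 1) X) :
    IsZero (virtualTruncation (preadditiveYoneda.obj I) T) ↔
      ∀ f : T.upper.left ⟶ I, T.conn ≫ f = 0 := by
  have : IsZero (virtualTruncation (preadditiveYoneda.obj I) T) ↔
      (preadditiveYoneda.obj I).map T.conn.op = 0 := by
    constructor
    · intro h
      rw [← image.fac ((preadditiveYoneda.obj I).map T.conn.op)]
      exact (h.eq_of_tgt (factorThruImage _) 0).symm ▸ zero_comp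
    · intro h
      exact (isZero_zero _).of_iso (imageZero' h)
  rw [this]
  constructor
  · intro h f
    exact ConcreteCategory.congr_hom h f
  · intro h
    ext f
    exact h f

/-- An object without weights `m, …, n` has vanishing virtual `t`-truncations `τ_{≤n}` of functors
represented by objects of `C_{w ≥ m}`. -/
lemma IsWithoutWeights.isZero_virtualTruncation (hmn : m ≤ n) (hM : w.IsWithoutWeights m n M) {I : C}
    (hI : w.ge m I) (T : w.TruncationPair n (n + 1) M) :
    IsZero (virtualTruncation (preadditiveYoneda.obj I) T) := by
  rw [isZero_virtualTruncation_iff]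
  intro f
  obtain ⟨D, E, h, hh⟩ := hM
  rw [Category.comp_id] at hh
  obtain ⟨a, ha⟩ := D.exists_lift_of_le T.lower.left_le le_rfl T.lower.ι
  obtain ⟨b, hb⟩ := T.upper.exists_lift_of_le E.left_le (by lia) E.ι
  -- Uniqueness of connecting morphisms makes `T.conn` factor through an object of weight `≤ m - 1`,
  -- which has no nonzero morphism to `I`.
  have hconn : T.conn = a ≫ h ≫ b := T.upper.eq_of_comp_ι T.lower.left_le (lt_add_one n)
    (by simp only [Category.assoc, hb, hh, ha, T.conn_ι])
  rw [hconn, Category.assoc, Category.assoc,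
    zero_of_le_of_ge (by lia) E.left_le hI (b ≫ f), comp_zero, comp_zero]

lemma isWithoutWeights_of_isZero_virtualTruncation (D : w.Decomposition (m - 1) M)
    (T : w.TruncationPair n (n + 1) M)
    (h : IsZero (virtualTruncation (preadditiveYoneda.obj D.right) T)) :
    w.IsWithoutWeights m n M := by
  rw [isZero_virtualTruncation_iff] at h
  refine .of_comp_π_eq_zero T.lower D ?_
  rw [← T.conn_ι, Category.assoc, h]

/-- An object without weights `m, …, n` is a retract of an extension of an object of
`C_{w ≥ n+1}` by an object of `C_{w ≤ m-1}`. -/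
lemma IsWithoutWeights.exists_retract (hM : w.IsWithoutWeights m n M) :
    ∃ (M' A B : C), Nonempty (Retract M M') ∧ IsExtensionOf M' B A ∧
      w.ge (n + 1) B ∧ w.le (m - 1) A := by
  obtain ⟨D, E, h, hh⟩ := hM
  rw [Category.comp_id] at hh
  obtain ⟨M', i, q, hT⟩ := distinguished_cocone_triangle₂ (D.δ ≫ h⟦(1 : ℤ)⟧')
  obtain ⟨α, hα₁, hα₂⟩ : ∃ α : M ⟶ M', D.ι ≫ α = h ≫ i ∧ D.π ≫ 𝟙 D.right = α ≫ q :=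
    complete_distinguished_triangle_morphism₂ _ _ D.distinguished hT h (𝟙 D.right)
      (Category.id_comp _).symm
  have hδ : D.δ ≫ D.ι⟦(1 : ℤ)⟧' = 0 := comp_distTriang_mor_zero₃₁ _ D.distinguished
  obtain ⟨r, hr⟩ : ∃ r : M' ⟶ M, i ≫ r = E.ι := by
    obtain ⟨r, hr, -⟩ := complete_distinguished_triangle_morphism₂ _ _ hT
      (contractible_distinguished M) E.ι 0 (by
        change (D.δ ≫ h⟦(1 : ℤ)⟧') ≫ E.ι⟦(1 : ℤ)⟧' = 0 ≫ 0
        rw [Category.assoc, ← Functor.map_comp, hh, hδ, zero_comp])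
    exact ⟨r, hr.trans (Category.comp_id _)⟩
  rw [Category.comp_id] at hα₂
  -- `r` need not be a retraction of `α`; the error factors through `D.π = α ≫ q`, so subtracting `q
  -- ≫ g` from `r` corrects it.
  obtain ⟨g, hg⟩ : ∃ g : D.right ⟶ M, α ≫ r - 𝟙 M = D.π ≫ g :=
    Triangle.yoneda_exact₂ _ D.distinguished (α ≫ r - 𝟙 M) (by
      change D.ι ≫ (α ≫ r - 𝟙 M) = 0
      rw [Preadditive.comp_sub, ← Category.assoc, hα₁, Category.assoc, hr, hh, Category.comp_id,
        sub_self])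
  refine ⟨M', E.left, D.right, ⟨⟨α, r - q ≫ g, ?_⟩⟩, ⟨i, q, _, hT⟩, D.right_ge, E.left_le⟩
  rw [Preadditive.comp_sub, ← Category.assoc, ← hα₂, ← hg, sub_sub_cancel]

lemma IsOfWeightRange.isZero_of_retract_of_isExtensionOf {A : Type*} [Category* A] [Abelian A]
    {H : Cᵒᵖ ⥤ A} (hH : w.IsOfWeightRange m n H) {M' L R : C} (r : Retract M M')
    (hM' : IsExtensionOf M' R L) (hR : w.ge (n + 1) R) (hL : w.le (m - 1) L) :
    IsZero (H.obj (op M)) := by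
  have := hH.cohomological
  obtain ⟨f, g, h, hT⟩ := hM'
  have hM' : IsZero (H.obj (op M')) :=
    (H.map_distinguished_op_exact _ hT).isZero_of_both_zeros
      ((hH.isZero_of_ge R hR).eq_of_src _ _) ((hH.isZero_of_le L hL).eq_of_tgt _ _)
  rw [IsZero.iff_id_eq_zero, ← H.map_id, ← op_id, ← r.retract, op_comp, H.map_comp,
    hM'.eq_of_src (H.map r.i.op) 0, comp_zero]

lemma isWithoutWeights_of_forall_isZero (hmn : m ≤ n)
    (h : ∀ (A : Type (max (v + 1) uA)) [Category.{max v vA} A] [Abelian A] (H : Cᵒᵖ ⥤ A),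
      w.IsOfWeightRange m n H → IsZero (H.obj (op M))) : w.IsWithoutWeights m n M := by
  obtain ⟨E⟩ := w.exists_decomposition (m - 1) M
  obtain ⟨B, _, _, ⟨e⟩⟩ := exists_abelian_equivalence_ulift.{v + 1, v, uA, vA} AddCommGrpCat.{v}
  have hH := truncYoneda_isOfWeightRange (n := n) (by lia) E.right_ge_pred
  have h₀ : IsZero ((w.truncYoneda n E.right).obj (op M)) :=
    (e.inverse.map_isZero (h B _ (hH.comp_equivalence e))).of_iso (e.unitIso.app _)
  rw [isZero_truncYoneda_iff] at h₀
  refine .of_comp_π_eq_zero (w.decomposition n M) E (h₀ _ fun L hL g hg ↦ ?_)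
  rw [← Category.assoc, hg, zero_comp]

/-- If the idempotents of `C` split, an object without weights `m, …, n` is itself an extension
of an object of `C_{w ≥ n+1}` by an object of `C_{w ≤ m-1}`. -/
lemma IsWithoutWeights.exists_isExtensionOf [IsIdempotentComplete C] (hmn : m ≤ n)
    (hM : w.IsWithoutWeights m n M) :
    ∃ (A B : C), IsExtensionOf M B A ∧ w.ge (n + 1) B ∧ w.le (m - 1) A := by
  obtain ⟨D, E, h, hh⟩ := hM
  rw [Category.comp_id] at hh
  obtain ⟨c, hc⟩ := D.exists_lift_of_le E.left_le (by lia) E.ι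
  -- Both sides lie over `M`, and `m - 1 < n` gives uniqueness.
  have hchc : c ≫ h ≫ c = c := D.eq_of_comp_ι E.left_le (by lia) (by simp [hc, hh])
  obtain ⟨P, i, p, hip, hpi⟩ := IsIdempotentComplete.idempotents_split E.left (c ≫ h)
    (by simpa using hchc =≫ h)
  obtain ⟨B, g, δ, hT⟩ := distinguished_cocone_triangle (i ≫ E.ι)
  refine ⟨P, B, ⟨_, g, δ, hT⟩, ge_succ_of_forall_zero fun X hX f ↦ ?_,
    le_of_retract ⟨i, p, hip⟩ E.left_le⟩
  have hs : (i ≫ c) ≫ h ≫ p = 𝟙 P := by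
    rw [Category.assoc, ← Category.assoc c, ← hpi, Category.assoc, hip, Category.comp_id, hip]
  -- Since `i ≫ c` is a split monomorphism, it suffices to kill `f ≫ δ` after `(i ≫ c)⟦1⟧'`, where
  -- it factors through a morphism `X ⟶ D.right`, zero by orthogonality.
  have hδ : f ≫ δ = 0 := by
    have hδ₀ : δ ≫ (i ≫ E.ι)⟦(1 : ℤ)⟧' = 0 := comp_distTriang_mor_zero₃₁ _ hT
    obtain ⟨b, hb⟩ := exists_comp_eq_of_comp_shift_map_eq_zero D.distinguished
      ((f ≫ δ) ≫ (i ≫ c)⟦(1 : ℤ)⟧') (by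
        rw [Category.assoc, Category.assoc, ← Functor.map_comp, Category.assoc i c, hc, hδ₀,
          comp_zero])
    rw [zero_of_le_of_ge_succ hX D.right_ge b, zero_comp] at hb
    rw [← Category.comp_id (f ≫ δ), ← (shiftFunctor C (1 : ℤ)).map_id, ← hs, Functor.map_comp, ← Category.assoc,
      ← hb, zero_comp]
  obtain ⟨b, rfl⟩ : ∃ b : X ⟶ M, f = b ≫ g := Triangle.coyoneda_exact₃ _ hT f hδ
  -- Now `b` factors through `D.ι`, hence through `E.ι` and then through `i ≫ E.ι`, which `g`
  -- annihilates.
  obtain ⟨a, rfl⟩ := D.exists_lift_of_le hX le_rfl b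
  have hιg : (i ≫ E.ι) ≫ g = 0 := comp_distTriang_mor_zero₁₂ _ hT
  have hE : E.ι = p ≫ i ≫ E.ι := by
    rw [← Category.assoc, hpi, Category.assoc, hh, hc]
  rw [← hh, hE]
  simp only [Category.assoc] at hιg ⊢
  rw [hιg, comp_zero, comp_zero, comp_zero]

/-- A triangle exhibiting `M` as an extension of an object of `C_{w ≥ n+1}` by an object of
`C_{w ≤ m-1}` is a weight decomposition for all indices between `m - 1` and `n`. -/
lemma exists_truncationPair_isIso_of_isExtensionOf {A B : C} (hM : IsExtensionOf M B A)
    (hB : w.ge (n + 1) B) (hA : w.le (m - 1) A) {k l : ℤ} (hk : m - 1 ≤ k) (hkl : k ≤ l)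
    (hl : l ≤ n) : ∃ T : w.TruncationPair k l M, IsIso T.conn := by
  obtain ⟨f, g, h, hT⟩ := hM
  exact ⟨
    { lower := ⟨A, B, f, g, h, hT, le_mono hk _ hA, ge_anti (by lia) _ hB⟩
      upper := ⟨A, B, f, g, h, hT, le_mono (by lia) _ hA, ge_anti (by lia) _ hB⟩
      conn := 𝟙 A
      conn_ι := Category.id_comp f }, (inferInstance : IsIso (𝟙 A))⟩

lemma exists_isExtensionOf_of_iso (D : w.Decomposition (m - 1) M) (E : w.Decomposition n M)
    (e : D.left ≅ E.left) :
    ∃ (A B : C), IsExtensionOf M B A ∧ w.ge (n + 1) B ∧ w.le (m - 1) A :=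
  ⟨E.left, E.right, ⟨E.ι, E.π, E.δ, E.distinguished⟩, E.right_ge,
    (w.le (m - 1)).prop_of_iso e D.left_le⟩

end WeightStructure

end

theorem theorem2p4 {C : Type u} [Category.{v} C] [Preadditive C] [HasZeroObject C]
    [HasShift C ℤ] [∀ k : ℤ, (shiftFunctor C k).Additive] [Pretriangulated C] [IsTriangulated C]
    (w : WeightStructure C) (m n : ℤ) (hmn : m ≤ n) (M : C) :
    -- Part I
    List.TFAE [
      w.IsWithoutWeights m n M,
      ∃ (M' A B : C), Nonempty (Retract M M') ∧ IsExtensionOf M' B A ∧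
        w.ge (n + 1) B ∧ w.le (m - 1) A,
      ∀ (A : Type (max (v + 1) uA)) [Category.{max v vA} A] [Abelian A] (H : Cᵒᵖ ⥤ A),
        w.IsOfWeightRange m n H → IsZero (H.obj (op M)),
      -- vanishing of `τ_{≤n}(H_I)(M)` for all `I`, for all (resp. some) choices of truncations
      ∀ I : C, w.ge m I → ∀ T : w.TruncationPair n (n + 1) M,
        IsZero (WeightStructure.virtualTruncation (preadditiveYoneda.obj I) T),
      ∀ I : C, w.ge m I → ∃ T : w.TruncationPair n (n + 1) M,
        IsZero (WeightStructure.virtualTruncation (preadditiveYoneda.obj I) T),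
      -- the same for `I₀ = w_{≥m} M`, for all (resp. some) choices of it and of truncations
      ∀ (D : w.Decomposition (m - 1) M) (T : w.TruncationPair n (n + 1) M),
        IsZero (WeightStructure.virtualTruncation (preadditiveYoneda.obj D.right) T),
      ∃ (D : w.Decomposition (m - 1) M) (T : w.TruncationPair n (n + 1) M),
        IsZero (WeightStructure.virtualTruncation (preadditiveYoneda.obj D.right) T)] ∧
    -- Part II
    (IsIdempotentComplete C → List.TFAE [
      w.IsWithoutWeights m n M,
      ∃ (A B : C), IsExtensionOf M B A ∧ w.ge (n + 1) B ∧ w.le (m - 1) A,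
      ∃ (D : w.Decomposition (m - 1) M) (E : w.Decomposition n M), Nonempty (D.left ≅ E.left),
      ∃ T : w.TruncationPair (m - 1) n M, IsIso T.conn]) := by
  constructor
  · tfae_have 1 → 2 := WeightStructure.IsWithoutWeights.exists_retract
    tfae_have 2 → 3 := by
      rintro ⟨M', L, R, ⟨r⟩, hM', hR, hL⟩ A _ _ H hH
      exact hH.isZero_of_retract_of_isExtensionOf r hM' hR hL
    tfae_have 3 → 1 := WeightStructure.isWithoutWeights_of_forall_isZero.{u, v, uA, vA} hmn
    tfae_have 1 → 4 := fun hM I hI T ↦ hM.isZero_virtualTruncation hmn hI T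
    tfae_have 4 → 5 := fun h I hI ↦
      (w.exists_truncationPair (by lia) M).elim fun T ↦ ⟨T, h I hI T⟩
    tfae_have 4 → 6 := fun h D T ↦ h D.right D.right_ge_pred T
    tfae_have 5 → 7 := fun h ↦
      (w.exists_decomposition (m - 1) M).elim fun D ↦ ⟨D, h D.right D.right_ge_pred⟩
    tfae_have 6 → 7 := fun h ↦
      (w.exists_decomposition (m - 1) M).elim fun D ↦
        (w.exists_truncationPair (by lia) M).elim fun T ↦ ⟨D, T, h D T⟩
    tfae_have 7 → 1 := fun ⟨D, T, h⟩ ↦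
      WeightStructure.isWithoutWeights_of_isZero_virtualTruncation D T h
    tfae_finish
  · intro _
    tfae_have 1 → 2 := WeightStructure.IsWithoutWeights.exists_isExtensionOf hmn
    tfae_have 2 → 4 := fun ⟨_, _, hM, hB, hA⟩ ↦
      WeightStructure.exists_truncationPair_isIso_of_isExtensionOf hM hB hA le_rfl (by lia) le_rfl
    tfae_have 4 → 3 := fun ⟨T, _⟩ ↦ ⟨T.lower, T.upper, ⟨asIso T.conn⟩⟩
    tfae_have 3 → 2 := fun ⟨D, E, ⟨e⟩⟩ ↦ WeightStructure.exists_isExtensionOf_of_iso D E e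
    tfae_have 4 → 1 := fun ⟨T, _⟩ ↦
      ⟨T.upper, T.lower, inv T.conn, by rw [IsIso.inv_comp_eq, Category.comp_id, T.conn_ι]⟩
    tfae_finish
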